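/- Let $G=(V,E)$ be a finite graph, possibly with loops or multiple edges, with complex edge weights $\lambda=(\lambda_e)_{e\in E}$. For $H\subseteq E$ and $v\in V$ let $\deg(H,v)$ be the degree of $v$ in the spanning subgraph $(V,H)$ (a loop at $v$ counts twice), and write $\deg(G,v)=\deg(E,v)$. For each $v\in V$ let $u^{(v)}_0,\dots,u^{(v)}_{d}$ with $d=\deg(G,v)$ be complex numbers (the activities at $v$). Put $$Z(G,\lambda,u;x)=\sum_{H\subseteq E}\Big(\prod_{e\in H}\lambda_e\Big)\Big(\prod_{v\in V}u^{(v)}_{\deg(H,v)}\,x_v^{\deg(H,v)}\Big),\qquad K_v(z)=\sum_{j=0}^{d}\binom{d}{j}u^{(v)}_j z^j\quad(d=\deg(G,v)).$$ For $A\subseteq\mathbb{C}$, a polynomial $F$ in complex variables is called $A$-nonvanishing if either $F$ is identically zero, or $F\neq 0$ whenever all of its variables take values in $A$. For $0<\theta\le\pi$ let $S[\theta]=\{z\in\mathbb{C}: z\ne 0,\ |\arg z|<\theta\}$, where $-\pi<\arg z\le\pi$; for $\kappa>0$ let $\kappa D=\{z\in\mathbb{C}:|z|<\kappa\}$ and $\kappa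 E=\{z\in\mathbb{C}:|z|>\kappa\}$. **Theorem.** (a) Let $0\le\alpha<\pi/2$. If $\lambda_e$ is real and $\lambda_e\ge 0$ for every $e\in E$, and $K_v$ is $S[\pi-\alpha]$-nonvanishing for every $v\in V$, then $Z(G,\lambda,u;x)$ is $S[\pi/2-\alpha]$-nonvanishing. (b) Let $\kappa>0$ and $\lambda_{\max}>0$. If $|\lambda_e|\le\lambda_{\max}$ for every $e\in E$, and $K_v$ is $\kappa D$-nonvanishing for every $v\in V$, then $Z(G,\lambda,u;x)$ is $(\kappa/\lambda_{\max}^{1/2})D$-nonvanishing. (c) Let $\kappa>0$ and $\lambda_{\min}>0$. If $|\lambda_e|\ge\lambda_{\min}$ for every $e\in E$, and $K_v$ is $\kappa E$-nonvanishing with $\deg K_v=\deg(G,v)$ for every $v\in V$, then $Z(G,\lambda,u;x)$ is $(\kappa/\lambda_{\min}^{1/2})E$-nonvanishing. -/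

import Mathlib

open scoped Graph ComplexOrder

noncomputable section

open Classical in
/-- The degree `deg(H, v)` of the vertex `v` in the spanning subgraph of the multigraph `G` with
edge set `H ⊆ E(G)`: the number of edges of `H` incident with `v`, every loop at `v` being
counted twice. -/
def Graph.degreeIn {α β : Type*} (G : Graph α β) (H : Finset E(G)) (v : V(G)) : ℕ :=
  (H.filter fun e : E(G) => G.Inc e v).card + (H.filter fun e : E(G) => G.IsLoopAt e v).card

/-- The degree `deg(G, v)` of a vertex in a multigraph with finitely many edges. -/
def Graph.degree {α β : Type*} (G : Graph α β) [Fintype E(G)] (v : V(G)) : ℕ :=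
  G.degreeIn Finset.univ v

/-- The polynomial `Z(G, lam, u; x) = ∑_{H ⊆ E} lam^H u_{deg H} x^{deg H}` in the variables
`x_v`, `v ∈ V(G)`.  Only the activities `u v j` with `j ≤ deg(G, v)` occur in it. -/
def Graph.subgraphPoly {α β : Type*} (G : Graph α β) [Fintype V(G)] [Fintype E(G)]
    (lam : E(G) → ℂ) (u : V(G) → ℕ → ℂ) : MvPolynomial V(G) ℂ :=
  ∑ H : Finset E(G),
    MvPolynomial.C ((∏ e ∈ H, lam e) * ∏ v : V(G), u v (G.degreeIn H v)) *
      ∏ v : V(G), MvPolynomial.X v ^ G.degreeIn H v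

/-- The key polynomial `K_v(z) = ∑_{j=0}^{d} (d choose j) u_j^{(v)} z^j` with `d = deg(G, v)`. -/
def Graph.keyPoly {α β : Type*} (G : Graph α β) [Fintype E(G)]
    (u : V(G) → ℕ → ℂ) (v : V(G)) : Polynomial ℂ :=
  ∑ j ∈ Finset.range (G.degree v + 1),
    Polynomial.C (((G.degree v).choose j : ℂ) * u v j) * Polynomial.X ^ j

/-- A polynomial in several complex variables is `A`-nonvanishing if it is identically zero or
it does not vanish when all its variables lie in `A`. -/
def MvPolynomial.IsNonvanishing {σ : Type*} (A : Set ℂ) (F : MvPolynomial σ ℂ) : Prop :=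
  F = 0 ∨ ∀ z : σ → ℂ, (∀ v, z v ∈ A) → MvPolynomial.eval z F ≠ 0

/-- A polynomial in one complex variable is `A`-nonvanishing if it is identically zero or
it does not vanish at any point of `A`. -/
def Polynomial.IsNonvanishing (A : Set ℂ) (K : Polynomial ℂ) : Prop :=
  K = 0 ∨ ∀ z ∈ A, K.eval z ≠ 0

/-- The open sector `S[θ]`. -/
def openSector (θ : ℝ) : Set ℂ := {z | z ≠ 0 ∧ |z.arg| < θ}

/-- The open disk `κD`, of radius `κ` about the origin. -/
def openDisk (κ : ℝ) : Set ℂ := {z | ‖z‖ < κ}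

/-- The open exterior `κE` of the disk of radius `κ` about the origin. -/
def openExterior (κ : ℝ) : Set ℂ := {z | κ < ‖z‖}

end

/-! Let L be the linear functional sending `∏ X_v ^ m_v` to `∏ u_v(m_v) x_v ^ m_v`. Then Z(x) =
L(∏_e (1 + λ_e X_s X_t)), where s and t are the ends of e. Compare ∏_e (1 + z_e X_s)(1 + z_e X_t): L
splits it over the vertices, and the factor at v is the polarization of K_v(x_v z), taken at the z_e
of the edge ends at v. If no K_v(x_v z) has a zero in S, a disk or half-plane, Grace–Walsh–Szegő
(`IsLaguerreSet.umbralEval_prod_ne_zero`) makes this nonzero for all z_e in S.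

In a single z_e the value is a + b(z_e - δ) + d(z_e - δ)², with δ in S. If d ≠ 0, its roots r, r'
lie outside S, and Asano contraction replaces it by a + λ_e d = d((r - δ)(r' - δ) + λ_e), nonzero
once the product cannot equal -λ_e (`contraction_ne_zero`). Contracting every edge yields the
factors `edgeFactor δ (lam e)`, which are 1 + λ_e X_s X_t at δ = 0.

For (b), S is a disk about 0 and δ = 0. Part (c) reduces to (b) by complementing H. For (a), S is
the right half-plane, which omits 0; so δ > 0 tends to 0, and Hurwitz's theorem leaves the zero
polynomial as the only exception. -/

/-! ### Umbral functionals -/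

/-- The linear functional on univariate polynomials sending `X ^ j` to `u j`. -/
noncomputable def umbralEval {R : Type*} [CommRing R] (u : ℕ → R) : Polynomial R →ₗ[R] R :=
  (Polynomial.basisMonomials R).constr R u

theorem umbralEval_X_pow {R : Type*} [CommRing R] (u : ℕ → R) (j : ℕ) :
    umbralEval u (Polynomial.X ^ j) = u j := by
  have h := (Polynomial.basisMonomials R).constr_basis R u j
  rw [Polynomial.coe_basisMonomials] at h
  rwa [Polynomial.X_pow_eq_monomial]

theorem umbralEval_C_mul {R : Type*} [CommRing R] (u : ℕ → R) (c : R) (p : Polynomial R) :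
    umbralEval u (Polynomial.C c * p) = c * umbralEval u p := by
  rw [← Polynomial.smul_eq_C_mul, map_smul, smul_eq_mul]

theorem umbralEval_eq_sum {R : Type*} [CommRing R] (u : ℕ → R) (p : Polynomial R) :
    umbralEval u p = ∑ j ∈ Finset.range (p.natDegree + 1), p.coeff j * u j := by
  conv_lhs => rw [p.as_sum_range_C_mul_X_pow]
  simp only [map_sum, umbralEval_C_mul, umbralEval_X_pow]

/-- The linear functional on multivariate polynomials sending `∏ v, X v ^ m v` to
`∏ v, u v (m v)`. -/
noncomputable def mvUmbralEval {V R : Type*} [Fintype V] [CommRing R] (u : V → ℕ → R) :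
    MvPolynomial V R →ₗ[R] R :=
  (MvPolynomial.basisMonomials V R).constr R fun m => ∏ v, u v (m v)

section MvUmbral

variable {V R : Type*} [Fintype V] [CommRing R]

theorem mvUmbralEval_monomial (u : V → ℕ → R) (m : V →₀ ℕ) (c : R) :
    mvUmbralEval u (MvPolynomial.monomial m c) = c * ∏ v, u v (m v) := by
  have h := (MvPolynomial.basisMonomials V R).constr_basis R (fun m => ∏ v, u v (m v)) m
  rw [MvPolynomial.coe_basisMonomials] at h
  rw [← mul_one c, ← smul_eq_mul c, ← MvPolynomial.smul_monomial, map_smul, smul_eq_mul,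
    smul_eq_mul, mul_one, mvUmbralEval, h]

theorem mvUmbralEval_C_mul (u : V → ℕ → R) (c : R) (p : MvPolynomial V R) :
    mvUmbralEval u (MvPolynomial.C c * p) = c * mvUmbralEval u p := by
  rw [← MvPolynomial.smul_eq_C_mul, map_smul, smul_eq_mul]

theorem mvUmbralEval_prod_X_pow (u : V → ℕ → R) (m : V → ℕ) :
    mvUmbralEval u (∏ v, MvPolynomial.X v ^ m v) = ∏ v, u v (m v) := by
  have h := mvUmbralEval_monomial u (Finsupp.equivFunOnFinite.symm m) 1
  rw [MvPolynomial.monomial_eq, Finsupp.prod_fintype _ _ (by simp)] at h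
  simpa using h

/-- The functional is a tensor product of univariate ones, hence multiplicative across distinct
variables. -/
theorem mvUmbralEval_prod_aeval (u : V → ℕ → R) (p : V → Polynomial R) :
    mvUmbralEval u (∏ v, Polynomial.aeval (MvPolynomial.X v) (p v)) =
      ∏ v, umbralEval (u v) (p v) := by
  classical
  have h : ∀ v, Polynomial.aeval (MvPolynomial.X v : MvPolynomial V R) (p v) =
      ∑ j ∈ Finset.range ((p v).natDegree + 1),
        MvPolynomial.C ((p v).coeff j) * MvPolynomial.X v ^ j := by
    intro v
    rw [Polynomial.aeval_eq_sum_range]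
    simp only [MvPolynomial.smul_eq_C_mul]
  simp only [h, umbralEval_eq_sum, Finset.prod_univ_sum, map_sum, Finset.prod_mul_distrib]
  refine Finset.sum_congr rfl fun m _ => ?_
  rw [← map_prod, mvUmbralEval_C_mul, mvUmbralEval_prod_X_pow]

theorem map_mvUmbralEval {S : Type*} [CommRing S] (φ : R →+* S) (u : V → ℕ → R)
    (p : MvPolynomial V R) :
    φ (mvUmbralEval u p) = mvUmbralEval (fun v j => φ (u v j)) (MvPolynomial.map φ p) := by
  induction p using MvPolynomial.induction_on' with
  | monomial m c => simp [mvUmbralEval_monomial]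
  | add p q hp hq => simp [hp, hq]

end MvUmbral

/-! ### Laguerre's theorem and Grace–Walsh–Szegő -/

/-- A set such that, for any two of its points `y` and `z`, the Möbius map
`r ↦ (y - r) / (z - r)` sends the complement of the set, including the point at infinity, into an
open half-plane bounded by a line through the origin. -/
def IsLaguerreSet (S : Set ℂ) : Prop :=
  ∀ y ∈ S, ∀ z ∈ S, ∃ c : ℂ, 0 < c.re ∧ ∀ r ∉ S, 0 < (c * ((y - r) / (z - r))).re

theorem isLaguerreSet_openDisk (κ : ℝ) : IsLaguerreSet (openDisk κ) := by
  intro y hy z hz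
  have hκ : 0 < κ := (norm_nonneg y).trans_lt hy
  have hy2 : y.re ^ 2 + y.im ^ 2 < κ ^ 2 := by
    have := pow_lt_pow_left₀ hy (norm_nonneg y) two_ne_zero
    rw [Complex.sq_norm, Complex.normSq_apply] at this
    nlinarith
  have hz2 : z.re ^ 2 + z.im ^ 2 < κ ^ 2 := by
    have := pow_lt_pow_left₀ hz (norm_nonneg z) two_ne_zero
    rw [Complex.sq_norm, Complex.normSq_apply] at this
    nlinarith
  -- For y ≠ z the complement of the disk is mapped to a closed disk missing 0, centred at the image
  -- of the reflection of z in the circle. The constant is a positive multiple of the conjugate of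
  -- that centre.
  refine ⟨κ ^ 2 - star y * z, ?_, fun r hr => ?_⟩
  · have : ((κ : ℂ) ^ 2 - star y * z).re = κ ^ 2 - (y.re * z.re + y.im * z.im) := by
      simp [← Complex.ofReal_pow]
    rw [this]
    nlinarith [sq_nonneg (y.re - z.re), sq_nonneg (y.im - z.im)]
  · have hr2 : κ ^ 2 ≤ r.re ^ 2 + r.im ^ 2 := by
      have hr' : κ ≤ ‖r‖ := not_lt.mp hr
      have := pow_le_pow_left₀ hκ.le hr' 2
      rw [Complex.sq_norm, Complex.normSq_apply] at this
      nlinarith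
    have hzr : 0 < Complex.normSq (z - r) := by
      rw [Complex.normSq_pos, sub_ne_zero]
      rintro rfl
      exact hr hz
    have key : (((κ : ℂ) ^ 2 - star y * z) * ((y - r) / (z - r))).re =
        (((κ : ℂ) ^ 2 - star y * z) * (y - r) * star (z - r)).re / Complex.normSq (z - r) := by
      rw [div_eq_mul_inv, Complex.inv_def, ← mul_assoc, ← mul_assoc, Complex.re_mul_ofReal,
        ← div_eq_mul_inv]
      rfl
    rw [key]
    refine div_pos ?_ hzr
    have : 2 * (((κ : ℂ) ^ 2 - star y * z) * (y - r) * star (z - r)).re =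
        (κ ^ 2 - (y.re ^ 2 + y.im ^ 2)) * ((z.re - r.re) ^ 2 + (z.im - r.im) ^ 2) +
        (κ ^ 2 - (z.re ^ 2 + z.im ^ 2)) * ((y.re - r.re) ^ 2 + (y.im - r.im) ^ 2) +
        (r.re ^ 2 + r.im ^ 2 - κ ^ 2) * ((y.re - z.re) ^ 2 + (y.im - z.im) ^ 2) := by
      simp [← Complex.ofReal_pow]
      ring
    have h1 : 0 < (κ ^ 2 - (y.re ^ 2 + y.im ^ 2)) *
        ((z.re - r.re) ^ 2 + (z.im - r.im) ^ 2) := by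
      refine mul_pos (by linarith) ?_
      rw [Complex.normSq_apply, Complex.sub_re, Complex.sub_im] at hzr
      linarith
    have h2 : 0 ≤ (κ ^ 2 - (z.re ^ 2 + z.im ^ 2)) *
        ((y.re - r.re) ^ 2 + (y.im - r.im) ^ 2) :=
      mul_nonneg (by linarith) (by positivity)
    have h3 : 0 ≤ (r.re ^ 2 + r.im ^ 2 - κ ^ 2) *
        ((y.re - z.re) ^ 2 + (y.im - z.im) ^ 2) :=
      mul_nonneg (by linarith) (by positivity)
    linarith

theorem isLaguerreSet_rightHalfPlane : IsLaguerreSet {z : ℂ | 0 < z.re} := by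
  intro y (hy : 0 < y.re) z (hz : 0 < z.re)
  -- Again the conjugate of the image of the reflected point, here -star z, up to a positive factor.
  refine ⟨star y + z, by simp; linarith, fun r hr => ?_⟩
  have hr' : r.re ≤ 0 := not_lt.mp hr
  have hzr : 0 < Complex.normSq (z - r) := by
    rw [Complex.normSq_pos, sub_ne_zero]
    rintro rfl
    exact hr hz
  have key : ((star y + z) * ((y - r) / (z - r))).re =
      ((star y + z) * (y - r) * star (z - r)).re / Complex.normSq (z - r) := by
    rw [div_eq_mul_inv, Complex.inv_def, ← mul_assoc, ← mul_assoc, Complex.re_mul_ofReal,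
      ← div_eq_mul_inv]
    rfl
  rw [key]
  refine div_pos ?_ hzr
  have : ((star y + z) * (y - r) * star (z - r)).re =
      y.re * ((z.re - r.re) ^ 2 + (z.im - r.im) ^ 2) +
      z.re * ((y.re - r.re) ^ 2 + (y.im - r.im) ^ 2) -
      r.re * ((y.re - z.re) ^ 2 + (y.im - z.im) ^ 2) := by
    simp
    ring
  rw [this]
  have h1 : 0 < y.re * ((z.re - r.re) ^ 2 + (z.im - r.im) ^ 2) := by
    refine mul_pos hy ?_
    rw [Complex.normSq_apply, Complex.sub_re, Complex.sub_im] at hzr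
    linarith
  have h2 : 0 ≤ z.re * ((y.re - r.re) ^ 2 + (y.im - r.im) ^ 2) :=
    mul_nonneg hz.le (by positivity)
  have h3 : 0 ≤ -r.re * ((y.re - z.re) ^ 2 + (y.im - z.im) ^ 2) :=
    mul_nonneg (by linarith) (by positivity)
  linarith

/-- Laguerre's theorem on polar derivatives. -/
theorem IsLaguerreSet.polar_ne_zero {S : Set ℂ} (hS : IsLaguerreSet S) {p : Polynomial ℂ} {n : ℕ}
    (hn : n ≠ 0) (hp : p.natDegree ≤ n) (h : ∀ z ∈ S, p.eval z ≠ 0) {y z : ℂ} (hy : y ∈ S)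
    (hz : z ∈ S) : n * p.eval z + (y - z) * p.derivative.eval z ≠ 0 := by
  intro h0
  obtain ⟨c, hc, hcr⟩ := hS y hy z hz
  have hpz := h z hz
  have hroot : ∀ r ∈ p.roots, r ∉ S := fun r hr hrS =>
    h r hrS (Polynomial.isRoot_of_mem_roots hr)
  have hd := (IsAlgClosed.splits p).eval_derivative_div_eval_of_ne_zero hpz
  have hsum : (p.roots.map fun r => (y - r) / (z - r)).sum =
      p.natDegree + (y - z) * (p.roots.map fun r => 1 / (z - r)).sum := by
    have : ∀ r ∈ p.roots, (y - r) / (z - r) = 1 + (y - z) * (1 / (z - r)) := by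
      intro r hr
      have : z - r ≠ 0 := by
        rw [sub_ne_zero]
        rintro rfl
        exact hroot _ hr hz
      field_simp
      ring
    rw [Multiset.map_congr rfl this, Multiset.sum_map_add, Multiset.sum_map_mul_left]
    simp [IsAlgClosed.card_roots_eq_natDegree]
  -- The n - deg p missing roots count as roots at infinity, each contributing 1. So n ≥ 1 numbers
  -- in one open half-plane through 0 would sum to zero.
  have hzero : ((n - p.natDegree : ℕ) : ℂ) + (p.roots.map fun r => (y - r) / (z - r)).sum = 0 := by
    rw [hsum, ← hd, Nat.cast_sub hp]
    field_simp
    linear_combination h0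
  have hre := congrArg (fun w => (c * w).re) hzero
  have hmap : (c * (p.roots.map fun r => (y - r) / (z - r)).sum).re =
      (p.roots.map fun r => (c * ((y - r) / (z - r))).re).sum := by
    rw [← Multiset.sum_map_mul_left]
    have := map_multiset_sum Complex.reAddGroupHom (p.roots.map fun r => c * ((y - r) / (z - r)))
    rwa [Multiset.map_map] at this
  simp only [mul_add, Complex.add_re, hmap, mul_zero, Complex.zero_re] at hre
  rw [mul_comm c, ← nsmul_eq_mul, Complex.re_nsmul] at hre
  have hnn : 0 ≤ (p.roots.map fun r => (c * ((y - r) / (z - r))).re).sum :=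
    Multiset.sum_nonneg fun x hx => by
      obtain ⟨r, hr, rfl⟩ := Multiset.mem_map.mp hx
      exact (hcr r (hroot r hr)).le
  rcases hp.lt_or_eq with hlt | heq
  · have : 0 < (n - p.natDegree) • c.re := nsmul_pos hc (Nat.sub_ne_zero_of_lt hlt)
    linarith
  · have hne : p.roots ≠ 0 := by
      rw [← Multiset.card_pos, IsAlgClosed.card_roots_eq_natDegree]
      omega
    obtain ⟨r, hr⟩ := Multiset.exists_mem_of_ne_zero hne
    obtain ⟨s, hs⟩ := Multiset.exists_cons_of_mem hr
    rw [hs, Multiset.map_cons, Multiset.sum_cons] at hre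
    have h1 := hcr r (hroot r hr)
    have h2 : 0 ≤ (s.map fun r => (c * ((y - r) / (z - r))).re).sum :=
      Multiset.sum_nonneg fun x hx => by
        obtain ⟨r', hr', rfl⟩ := Multiset.mem_map.mp hx
        exact (hcr r' (hroot r' (hs ▸ Multiset.mem_cons_of_mem hr'))).le
    have h3 : 0 ≤ (n - p.natDegree) • c.re := nsmul_nonneg hc.le _
    linarith

theorem umbralEval_one_add_C_mul_X_pow (u : ℕ → ℂ) (n : ℕ) (z : ℂ) :
    umbralEval u ((1 + Polynomial.C z * Polynomial.X) ^ n) =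
      (∑ j ∈ Finset.range (n + 1), Polynomial.C ((n.choose j : ℂ) * u j) *
        Polynomial.X ^ j : Polynomial ℂ).eval z := by
  rw [add_comm, add_pow, map_sum, Polynomial.eval_finsetSum]
  refine Finset.sum_congr rfl fun j _ => ?_
  have : (Polynomial.C z * Polynomial.X) ^ j * 1 ^ (n - j) * ((n.choose j : ℕ) : Polynomial ℂ) =
      Polynomial.C (z ^ j * (n.choose j : ℂ)) * Polynomial.X ^ j := by
    simp only [mul_pow, one_pow, mul_one, map_mul, map_pow, map_natCast]
    ring
  rw [this, umbralEval_C_mul, umbralEval_X_pow]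
  simp only [Polynomial.eval_mul, Polynomial.eval_C, Polynomial.eval_pow, Polynomial.eval_X]
  ring

theorem natDegree_sum_choose_le (u : ℕ → ℂ) (n : ℕ) :
    (∑ j ∈ Finset.range (n + 1), Polynomial.C ((n.choose j : ℂ) * u j) *
        Polynomial.X ^ j : Polynomial ℂ).natDegree ≤ n :=
  Polynomial.natDegree_sum_le_of_forall_le _ _ fun _ hj =>
    (Polynomial.natDegree_C_mul_X_pow_le _ _).trans (Nat.lt_succ_iff.mp (Finset.mem_range.mp hj))

/-- The functional commutes with d/dz, applied here to (1 + zX)^(n+1). -/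
theorem derivative_sum_choose (u : ℕ → ℂ) (n : ℕ) (z : ℂ) :
    (∑ j ∈ Finset.range (n + 1 + 1), Polynomial.C (((n + 1).choose j : ℂ) * u j) *
        Polynomial.X ^ j : Polynomial ℂ).derivative.eval z =
      (n + 1) * umbralEval u (Polynomial.X * (1 + Polynomial.C z * Polynomial.X) ^ n) := by
  rw [add_comm 1, add_pow, Finset.mul_sum, map_sum, map_sum,
    Polynomial.eval_finsetSum, Finset.sum_range_succ', Finset.mul_sum]
  simp only [pow_zero, mul_one, Polynomial.derivative_C, Polynomial.eval_zero, add_zero]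
  refine Finset.sum_congr rfl fun j _ => ?_
  have : Polynomial.X * ((Polynomial.C z * Polynomial.X) ^ j * 1 ^ (n - j) *
      ((n.choose j : ℕ) : Polynomial ℂ)) =
      Polynomial.C (z ^ j * (n.choose j : ℂ)) * Polynomial.X ^ (j + 1) := by
    simp only [mul_pow, one_pow, mul_one, map_mul, map_pow, map_natCast]
    ring
  simp only [one_pow, mul_one] at this ⊢
  rw [this, umbralEval_C_mul, umbralEval_X_pow, Polynomial.derivative_C_mul_X_pow]
  simp only [Polynomial.eval_mul, Polynomial.eval_C, Polynomial.eval_pow, Polynomial.eval_X,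
    Nat.add_sub_cancel]
  have hch : ((n : ℂ) + 1) * (n.choose j : ℂ) = ((n + 1).choose (j + 1) : ℂ) * ((j : ℂ) + 1) := by
    exact_mod_cast Nat.add_one_mul_choose_eq n j
  push_cast
  linear_combination (-(u (j + 1) * z ^ j)) * hch

/-- The Grace–Walsh–Szegő theorem, in the form of a nonvanishing statement. -/
theorem IsLaguerreSet.umbralEval_prod_ne_zero {S : Set ℂ} (hS : IsLaguerreSet S)
    (s : Multiset ℂ) (u : ℕ → ℂ)
    (h : ∀ z ∈ S, umbralEval u ((1 + Polynomial.C z * Polynomial.X) ^ s.card) ≠ 0)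
    (hne : S.Nonempty) (hs : ∀ y ∈ s, y ∈ S) :
    umbralEval u (s.map fun y => 1 + Polynomial.C y * Polynomial.X).prod ≠ 0 := by
  induction s using Multiset.induction_on generalizing u with
  | empty =>
    obtain ⟨z, hz⟩ := hne
    simpa using h z hz
  | cons y s ih =>
    -- Fixing one factor 1 + yX amounts to replacing the sequence u by u_j + y u_{j+1}. Laguerre's
    -- theorem passes the hypothesis on to this new sequence.
    have hshift : ∀ p : Polynomial ℂ,
        umbralEval (fun j => u j + y * u (j + 1)) p =
          umbralEval u ((1 + Polynomial.C y * Polynomial.X) * p) := by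
      intro p
      induction p using Polynomial.induction_on' with
      | add p q hp hq => rw [map_add, hp, hq, mul_add, map_add]
      | monomial j c =>
        rw [← Polynomial.C_mul_X_pow_eq_monomial, umbralEval_C_mul, umbralEval_X_pow]
        have : (1 + Polynomial.C y * Polynomial.X) * (Polynomial.C c * Polynomial.X ^ j) =
            Polynomial.C c * Polynomial.X ^ j +
              Polynomial.C (c * y) * Polynomial.X ^ (j + 1) := by
          rw [map_mul]
          ring
        rw [this, map_add, umbralEval_C_mul, umbralEval_C_mul, umbralEval_X_pow, umbralEval_X_pow]
        ring
    have hy : y ∈ S := hs y (Multiset.mem_cons_self y s)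
    rw [Multiset.map_cons, Multiset.prod_cons, ← hshift]
    refine ih _ (fun z hz => ?_) fun w hw => hs w (Multiset.mem_cons_of_mem hw)
    rw [hshift]
    rw [Multiset.card_cons] at h
    have hpol := hS.polar_ne_zero (Nat.succ_ne_zero s.card) (natDegree_sum_choose_le u _)
      (fun w hw => by
        rw [← umbralEval_one_add_C_mul_X_pow]
        exact h w hw) hy hz
    rw [← umbralEval_one_add_C_mul_X_pow, derivative_sum_choose] at hpol
    intro h0
    apply hpol
    have : (1 + Polynomial.C y * Polynomial.X) * (1 + Polynomial.C z * Polynomial.X) ^ s.card =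
        (1 + Polynomial.C z * Polynomial.X) ^ (s.card + 1) +
        Polynomial.C (y - z) * (Polynomial.X * (1 + Polynomial.C z * Polynomial.X) ^ s.card) := by
      rw [map_sub]
      ring
    rw [this, map_add, umbralEval_C_mul] at h0
    push_cast
    linear_combination ((s.card : ℂ) + 1) * h0

/-! ### Asano contraction of edges -/

/-- Asano's contraction of a quadratic polynomial. -/
theorem contraction_ne_zero {S : Set ℂ} {δ l a b d : ℂ} (hδ : δ ∈ S)
    (hl : ∀ r ∉ S, ∀ r' ∉ S, (r - δ) * (r' - δ) + l ≠ 0)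
    (h : ∀ z ∈ S, a + b * (z - δ) + d * (z - δ) ^ 2 ≠ 0) : a + l * d ≠ 0 := by
  rcases eq_or_ne d 0 with rfl | hd
  · simpa using h δ hδ
  -- The two roots have displacements (-b ± s)/(2d) from δ, whose product is a/d.
  obtain ⟨s, hs⟩ := IsAlgClosed.exists_pow_nat_eq (b ^ 2 - 4 * d * a) two_pos
  have h1 : δ + (-b + s) / (2 * d) ∉ S := fun hS => by
    apply h _ hS
    field_simp
    linear_combination hs
  have h2 : δ + (-b - s) / (2 * d) ∉ S := fun hS => by
    apply h _ hS
    field_simp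
    linear_combination hs
  intro h0
  apply hl _ h1 _ h2
  field_simp
  linear_combination 4 * d * h0 - hs

section Contraction

variable {V ι R : Type*} [CommRing R]

/-- The factor attached to an edge with ends `v` and `w`. -/
noncomputable def edgeFactor (δ l : R) (v w : V) : MvPolynomial V R :=
  (1 + MvPolynomial.C δ * MvPolynomial.X v) * (1 + MvPolynomial.C δ * MvPolynomial.X w) +
    MvPolynomial.C l * (MvPolynomial.X v * MvPolynomial.X w)

theorem map_edgeFactor {S : Type*} [CommRing S] (φ : R →+* S) (δ l : R) (v w : V) :
    MvPolynomial.map φ (edgeFactor δ l v w) = edgeFactor (φ δ) (φ l) v w := by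
  simp [edgeFactor]

/-- One edge is contracted at a time, and `Q` collects the factors already contracted. The remaining
z_e stay arbitrary in S, so the hypothesis survives each contraction. -/
theorem contract_edges_ne_zero {S : Set ℂ} (L : MvPolynomial V ℂ →ₗ[ℂ] ℂ) (s t : ι → V)
    (lam : ι → ℂ) {δ : ℂ} (hδ : δ ∈ S)
    (hlam : ∀ e, ∀ r ∉ S, ∀ r' ∉ S, (r - δ) * (r' - δ) + lam e ≠ 0) (B : Finset ι)
    (Q : MvPolynomial V ℂ)
    (h : ∀ z : ι → ℂ, (∀ e, z e ∈ S) →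
      L (Q * ∏ e ∈ B, edgeFactor (z e) 0 (s e) (t e)) ≠ 0) :
    L (Q * ∏ e ∈ B, edgeFactor δ (lam e) (s e) (t e)) ≠ 0 := by
  classical
  induction B using Finset.induction_on generalizing Q with
  | empty => simpa using h (fun _ => δ) fun _ => hδ
  | insert e B he ih =>
    rw [Finset.prod_insert he, ← mul_assoc]
    refine ih _ fun z hz => ?_
    set P := Q * ∏ e ∈ B, edgeFactor (z e) 0 (s e) (t e) with hP
    have hq : ∀ w ∈ S, L (P * edgeFactor δ 0 (s e) (t e)) +
        L (P * (MvPolynomial.X (s e) * (1 + MvPolynomial.C δ * MvPolynomial.X (t e)) +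
          MvPolynomial.X (t e) * (1 + MvPolynomial.C δ * MvPolynomial.X (s e)))) * (w - δ) +
        L (P * (MvPolynomial.X (s e) * MvPolynomial.X (t e))) * (w - δ) ^ 2 ≠ 0 := by
      intro w hw
      have := h (Function.update z e w) fun f => by
        by_cases hf : f = e
        · subst hf
          simpa using hw
        · simpa [hf] using hz f
      rw [Finset.prod_insert he, Finset.prod_congr rfl fun f hf => by
        rw [Function.update_of_ne (ne_of_mem_of_not_mem hf he)], Function.update_self,
        mul_left_comm, ← hP, mul_comm] at this
      have key : P * edgeFactor w 0 (s e) (t e) = P * edgeFactor δ 0 (s e) (t e) +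
          (w - δ) • (P * (MvPolynomial.X (s e) * (1 + MvPolynomial.C δ * MvPolynomial.X (t e)) +
          MvPolynomial.X (t e) * (1 + MvPolynomial.C δ * MvPolynomial.X (s e)))) +
          ((w - δ) ^ 2) • (P * (MvPolynomial.X (s e) * MvPolynomial.X (t e))) := by
        simp only [edgeFactor, MvPolynomial.smul_eq_C_mul, map_sub, map_pow, map_zero]
        ring
      rw [key, map_add, map_add, map_smul, map_smul, smul_eq_mul, smul_eq_mul] at this
      rwa [mul_comm _ (w - δ), mul_comm _ ((w - δ) ^ 2)]
    have := contraction_ne_zero hδ (hlam e) hq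
    have key : Q * edgeFactor δ (lam e) (s e) (t e) *
        ∏ e ∈ B, edgeFactor (z e) 0 (s e) (t e) = P * edgeFactor δ 0 (s e) (t e) +
          lam e • (P * (MvPolynomial.X (s e) * MvPolynomial.X (t e))) := by
      simp only [hP, edgeFactor, MvPolynomial.smul_eq_C_mul, map_zero]
      ring
    rwa [key, map_add, map_smul, smul_eq_mul]

end Contraction

section Functional

variable {V ι : Type*} [Fintype V] [DecidableEq V] [Fintype ι]

/-- Before contraction every linear factor involves a single vertex, a loop giving two factors at
its vertex. Hence the functional factors over vertices and Grace–Walsh–Szegő applies at each. -/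
theorem mvUmbralEval_prod_edgeFactor_ne_zero {S : Set ℂ} (hS : IsLaguerreSet S) (s t : ι → V)
    (u : V → ℕ → ℂ)
    (hK : ∀ v, ∀ z ∈ S, umbralEval (u v) ((1 + Polynomial.C z * Polynomial.X) ^
      ((Finset.univ.filter fun e => s e = v).card +
        (Finset.univ.filter fun e => t e = v).card)) ≠ 0)
    (lam : ι → ℂ) {δ : ℂ} (hδ : δ ∈ S)
    (hlam : ∀ e, ∀ r ∉ S, ∀ r' ∉ S, (r - δ) * (r' - δ) + lam e ≠ 0) :
    mvUmbralEval u (∏ e, edgeFactor δ (lam e) (s e) (t e)) ≠ 0 := by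
  have := contract_edges_ne_zero (mvUmbralEval u) s t lam hδ hlam Finset.univ 1 ?_
  · rwa [one_mul] at this
  intro z hz
  have hprod : (1 * ∏ e, edgeFactor (z e) 0 (s e) (t e) : MvPolynomial V ℂ) =
      ∏ v, Polynomial.aeval (MvPolynomial.X v)
        (((Finset.univ.filter fun e => s e = v).val.map z +
          (Finset.univ.filter fun e => t e = v).val.map z).map
            fun y => 1 + Polynomial.C y * Polynomial.X).prod := by
    have hside : ∀ r : ι → V, (∏ v, Polynomial.aeval (MvPolynomial.X v : MvPolynomial V ℂ)
        (((Finset.univ.filter fun e => r e = v).val.map z).map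
            fun y => 1 + Polynomial.C y * Polynomial.X).prod) =
        ∏ e, (1 + MvPolynomial.C (z e) * MvPolynomial.X (r e)) := by
      intro r
      rw [← Finset.prod_fiberwise Finset.univ r]
      refine Finset.prod_congr rfl fun v _ => ?_
      rw [Multiset.map_map, map_multiset_prod, Multiset.map_map]
      refine Finset.prod_congr rfl fun e he => ?_
      rw [(Finset.mem_filter.mp he).2]
      simp [MvPolynomial.algebraMap_eq]
    simp only [Multiset.map_add, Multiset.prod_add, map_mul, Finset.prod_mul_distrib, edgeFactor,
      map_zero, zero_mul, add_zero, one_mul] at hside ⊢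
    rw [hside, hside]
  rw [hprod, mvUmbralEval_prod_aeval, Finset.prod_ne_zero_iff]
  intro v _
  refine hS.umbralEval_prod_ne_zero _ _ (fun w hw => ?_) ⟨δ, hδ⟩ fun y hy => ?_
  · rw [Multiset.card_add, Multiset.card_map, Multiset.card_map]
    exact hK v w hw
  · rw [Multiset.mem_add, Multiset.mem_map, Multiset.mem_map] at hy
    rcases hy with ⟨e, -, rfl⟩ | ⟨e, -, rfl⟩ <;> exact hz e

theorem mvUmbralEval_prod_edgeFactor_zero {R : Type*} [CommRing R] (s t : ι → V)
    (u : V → ℕ → R) (lam : ι → R) :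
    mvUmbralEval u (∏ e, edgeFactor 0 (lam e) (s e) (t e)) =
      ∑ H : Finset ι, (∏ e ∈ H, lam e) *
        ∏ v, u v ((H.filter fun e => s e = v).card + (H.filter fun e => t e = v).card) := by
  have h0 : ∀ e, edgeFactor 0 (lam e) (s e) (t e) =
      1 + MvPolynomial.C (lam e) * (MvPolynomial.X (s e) * MvPolynomial.X (t e)) := fun e => by
    simp [edgeFactor]
  simp only [h0, Finset.prod_one_add, map_sum, Finset.powerset_univ]
  refine Finset.sum_congr rfl fun H _ => ?_
  rw [Finset.prod_mul_distrib, ← map_prod, mvUmbralEval_C_mul, ← mvUmbralEval_prod_X_pow]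
  have hside : ∀ r : ι → V, ∏ e ∈ H, (MvPolynomial.X (r e) : MvPolynomial V R) =
      ∏ v, MvPolynomial.X v ^ (H.filter fun e => r e = v).card := by
    intro r
    rw [← Finset.prod_fiberwise H r]
    refine Finset.prod_congr rfl fun v _ => Finset.prod_eq_pow_card fun e he => ?_
    rw [(Finset.mem_filter.mp he).2]
  simp only [Finset.prod_mul_distrib, pow_add, hside]

end Functional

/-! ### Hurwitz's theorem for polynomials -/

/-- Every root s has |s| ≥ r, so |t - s| ≤ |s|(1 + |t|/r); multiply over the roots. -/
theorem Polynomial.norm_eval_le_of_ne_zero {p : Polynomial ℂ} {r : ℝ} (hr : 0 < r) {n : ℕ}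
    (hn : p.natDegree ≤ n) (h : ∀ t : ℂ, ‖t‖ < r → p.eval t ≠ 0) (t : ℂ) :
    ‖p.eval t‖ ≤ ‖p.eval 0‖ * (1 + ‖t‖ / r) ^ n := by
  have heval : ∀ w, ‖p.eval w‖ =
      ‖p.leadingCoeff‖ * (p.roots.map fun s => ‖w - s‖).prod := by
    intro w
    have := map_multiset_prod (normHom : ℂ →*₀ ℝ) (p.roots.map fun s => w - s)
    rw [Multiset.map_map] at this
    rw [(IsAlgClosed.splits p).eval_eq_prod_roots, norm_mul]
    exact congrArg _ this
  have hroots : ∀ s ∈ p.roots, ‖t - s‖ ≤ ‖0 - s‖ * (1 + ‖t‖ / r) := by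
    intro s hs
    have hrs : r ≤ ‖s‖ := by
      by_contra! hlt
      exact h s hlt (Polynomial.isRoot_of_mem_roots hs)
    have : ‖t‖ ≤ ‖s‖ * (‖t‖ / r) := by
      rw [mul_div_assoc', le_div_iff₀ hr, mul_comm ‖s‖]
      exact mul_le_mul_of_nonneg_left hrs (norm_nonneg t)
    rw [zero_sub, norm_neg, mul_add, mul_one]
    linarith [norm_sub_le t s]
  have hprod := Multiset.prod_map_le_prod_map₀ (fun s => ‖t - s‖)
    (fun s => ‖0 - s‖ * (1 + ‖t‖ / r)) (fun s _ => norm_nonneg _) hroots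
  rw [Multiset.prod_map_mul, Multiset.map_const', Multiset.prod_replicate,
    IsAlgClosed.card_roots_eq_natDegree] at hprod
  rw [heval, heval, mul_assoc]
  refine mul_le_mul_of_nonneg_left (hprod.trans ?_) (norm_nonneg _)
  refine mul_le_mul_of_nonneg_left (pow_le_pow_right₀ ?_ hn) ?_
  · have : 0 ≤ ‖t‖ / r := by positivity
    linarith
  · exact Multiset.prod_nonneg fun a ha => by
      obtain ⟨s, -, rfl⟩ := Multiset.mem_map.mp ha
      exact norm_nonneg _

/-- Hurwitz's theorem for a polynomial family of polynomials in one variable. -/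
theorem Polynomial.evalEval_zero_eq_zero {p : Polynomial (Polynomial ℂ)} {r : ℝ} (hr : 0 < r)
    (h : ∀ δ : ℝ, 0 < δ → ∀ t : ℂ, ‖t‖ < r → p.evalEval (δ : ℂ) t ≠ 0)
    (h0 : p.evalEval 0 0 = 0) (t : ℂ) : p.evalEval 0 t = 0 := by
  have hcont : ∀ w : ℂ, Filter.Tendsto (fun δ : ℝ => ‖p.evalEval (δ : ℂ) w‖)
      (nhdsWithin 0 (Set.Ioi 0)) (nhds ‖p.evalEval 0 w‖) := by
    intro w
    have : Continuous fun δ : ℝ => ‖p.evalEval (δ : ℂ) w‖ :=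
      ((Polynomial.continuous _).comp Complex.continuous_ofReal).norm
    simpa using (this.tendsto 0).mono_left nhdsWithin_le_nhds
  -- The exponent bounds the degree in t for all δ at once, so the estimate survives the limit δ →
  -- 0.
  have hle := le_of_tendsto_of_tendsto (hcont t)
    ((hcont 0).mul_const ((1 + ‖t‖ / r) ^ p.natDegree))
    (eventually_nhdsWithin_of_forall fun δ (hδ : 0 < δ) => by
      have := Polynomial.norm_eval_le_of_ne_zero (p := p.map (Polynomial.evalRingHom (δ : ℂ))) hr
        Polynomial.natDegree_map_le (fun t ht => by
          rw [Polynomial.map_evalRingHom_eval]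
          exact h δ hδ t ht) t
      simpa only [Polynomial.map_evalRingHom_eval] using this)
  rw [h0, norm_zero, zero_mul] at hle
  exact norm_le_zero_iff.mp hle

/-! ### Degrees and key polynomials of graphs -/

namespace Graph

variable {α β : Type*} (G : Graph α β)

theorem exists_ends : ∃ s t : E(G) → V(G), ∀ e : E(G), G.IsLink e (s e) (t e) := by
  have h : ∀ e : E(G), ∃ v w : V(G), G.IsLink e v w := fun e => by
    obtain ⟨x, y, hxy⟩ := G.exists_isLink_of_mem_edgeSet e.2
    exact ⟨⟨x, hxy.left_mem⟩, ⟨y, hxy.right_mem⟩, hxy⟩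
  choose s t hst using h
  exact ⟨s, t, hst⟩

variable {G}

/-- Incidence means that some end is v, a loop that both are; the count is inclusion–exclusion. -/
theorem degreeIn_eq_card_add_card [DecidableEq V(G)] {s t : E(G) → V(G)}
    (hst : ∀ e : E(G), G.IsLink e (s e) (t e)) (H : Finset E(G)) (v : V(G)) :
    G.degreeIn H v = (H.filter fun e => s e = v).card + (H.filter fun e => t e = v).card := by
  classical
  have hinc : ∀ e : E(G), G.Inc e v ↔ s e = v ∨ t e = v := fun e => by
    constructor
    · intro h
      rcases h.eq_or_eq_of_isLink (hst e) with h | h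
      · exact Or.inl (Subtype.ext h.symm)
      · exact Or.inr (Subtype.ext h.symm)
    · rintro (rfl | rfl)
      · exact (hst e).inc_left
      · exact (hst e).inc_right
  have hloop : ∀ e : E(G), G.IsLoopAt e v ↔ s e = v ∧ t e = v := fun e => by
    constructor
    · intro h
      exact ⟨Subtype.ext (h.eq_of_inc (hst e).inc_left).symm,
        Subtype.ext (h.eq_of_inc (hst e).inc_right).symm⟩
    · rintro ⟨h1, h2⟩
      have := hst e
      rwa [h1, h2] at this
  rw [← Finset.card_union_add_card_inter, ← Finset.filter_or, ← Finset.filter_and, degreeIn]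
  simp only [hinc, hloop]

variable [Fintype E(G)]

theorem degreeIn_add_degreeIn_compl [DecidableEq E(G)] (H : Finset E(G)) (v : V(G)) :
    G.degreeIn H v + G.degreeIn Hᶜ v = G.degree v := by
  classical
  obtain ⟨s, t, hst⟩ := G.exists_ends
  have hside : ∀ r : E(G) → V(G), (H.filter fun e => r e = v).card +
      (Hᶜ.filter fun e => r e = v).card = (Finset.univ.filter fun e => r e = v).card := by
    intro r
    rw [← Finset.card_union_of_disjoint, ← Finset.filter_union, Finset.union_compl]
    exact Finset.disjoint_filter_filter disjoint_compl_right
  rw [degree, degreeIn_eq_card_add_card hst, degreeIn_eq_card_add_card hst,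
    degreeIn_eq_card_add_card hst, ← hside s, ← hside t]
  ring

theorem degreeIn_le_degree (H : Finset E(G)) (v : V(G)) : G.degreeIn H v ≤ G.degree v := by
  classical
  exact (Nat.le_add_right _ _).trans (degreeIn_add_degreeIn_compl H v).le

theorem coeff_keyPoly (u : V(G) → ℕ → ℂ) (v : V(G)) {j : ℕ} (hj : j ≤ G.degree v) :
    (G.keyPoly u v).coeff j = (G.degree v).choose j * u v j := by
  simp only [keyPoly, Polynomial.finsetSum_coeff, Polynomial.coeff_C_mul_X_pow]
  rw [Finset.sum_ite_eq, if_pos (Finset.mem_range.mpr (Nat.lt_succ_of_le hj))]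

theorem eval_keyPoly (u : V(G) → ℕ → ℂ) (v : V(G)) (z : ℂ) :
    (G.keyPoly u v).eval z =
      ∑ j ∈ Finset.range (G.degree v + 1), (G.degree v).choose j * u v j * z ^ j := by
  simp [keyPoly, Polynomial.eval_finsetSum]

theorem umbralEval_mul_pow (u : V(G) → ℕ → ℂ) (v : V(G)) (x z : ℂ) :
    umbralEval (fun j => u v j * x ^ j)
      ((1 + Polynomial.C z * Polynomial.X) ^ G.degree v) = (G.keyPoly u v).eval (x * z) := by
  rw [umbralEval_one_add_C_mul_X_pow, eval_keyPoly, Polynomial.eval_finsetSum]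
  refine Finset.sum_congr rfl fun j _ => ?_
  simp only [Polynomial.eval_mul, Polynomial.eval_C, Polynomial.eval_pow, Polynomial.eval_X]
  ring

theorem eval_keyPoly_reverse (u : V(G) → ℕ → ℂ) (v : V(G)) {z : ℂ} (hz : z ≠ 0) :
    (G.keyPoly (fun v j => u v (G.degree v - j)) v).eval z =
      z ^ G.degree v * (G.keyPoly u v).eval z⁻¹ := by
  rw [eval_keyPoly, eval_keyPoly, Finset.mul_sum, ← Finset.sum_range_reflect]
  refine Finset.sum_congr rfl fun j hj => ?_
  have hj' : j ≤ G.degree v := Nat.lt_succ_iff.mp (Finset.mem_range.mp hj)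
  rw [Nat.add_sub_cancel, Nat.choose_symm hj', Nat.sub_sub_self hj', pow_sub₀ z hz hj', inv_pow]
  ring

variable [Fintype V(G)]

theorem eval_subgraphPoly (lam : E(G) → ℂ) (u : V(G) → ℕ → ℂ) (x : V(G) → ℂ) :
    MvPolynomial.eval x (G.subgraphPoly lam u) =
      ∑ H : Finset E(G), (∏ e ∈ H, lam e) *
        ∏ v, (u v (G.degreeIn H v) * x v ^ G.degreeIn H v) := by
  simp [subgraphPoly, Finset.prod_mul_distrib, mul_assoc]

theorem eval_subgraphPoly_eq_mvUmbralEval {s t : E(G) → V(G)}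
    (hst : ∀ e : E(G), G.IsLink e (s e) (t e)) (lam : E(G) → ℂ) (u : V(G) → ℕ → ℂ) (x : V(G) → ℂ) :
    MvPolynomial.eval x (G.subgraphPoly lam u) =
      mvUmbralEval (fun v j => u v j * x v ^ j) (∏ e, edgeFactor 0 (lam e) (s e) (t e)) := by
  classical
  rw [eval_subgraphPoly, mvUmbralEval_prod_edgeFactor_zero]
  simp only [degreeIn_eq_card_add_card hst]

/-- Binomial coefficients are nonzero in ℂ, so all relevant activities at v vanish, and every term
contains one. -/
theorem subgraphPoly_eq_zero_of_keyPoly_eq_zero (lam : E(G) → ℂ) {u : V(G) → ℕ → ℂ} {v : V(G)}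
    (h : G.keyPoly u v = 0) : G.subgraphPoly lam u = 0 := by
  refine Finset.sum_eq_zero fun H _ => ?_
  have hu : u v (G.degreeIn H v) = 0 := by
    have := coeff_keyPoly u v (degreeIn_le_degree H v)
    rw [h, Polynomial.coeff_zero, eq_comm, mul_eq_zero, Nat.cast_eq_zero] at this
    exact this.resolve_left (Nat.choose_pos (degreeIn_le_degree H v)).ne'
  rw [Finset.prod_eq_zero (Finset.mem_univ v) hu, mul_zero, map_zero, zero_mul]

/-- If some key polynomial vanishes identically then so does the subgraph polynomial, so that all
key polynomials may be assumed to have no zeros in the given set. -/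
theorem subgraphPoly_isNonvanishing_of {A B : Set ℂ} {lam : E(G) → ℂ} {u : V(G) → ℕ → ℂ}
    (hK : ∀ v, (G.keyPoly u v).IsNonvanishing A)
    (h : (∀ v, ∀ z ∈ A, (G.keyPoly u v).eval z ≠ 0) →
      (G.subgraphPoly lam u).IsNonvanishing B) : (G.subgraphPoly lam u).IsNonvanishing B := by
  by_cases h0 : ∃ v, G.keyPoly u v = 0
  · obtain ⟨v, hv⟩ := h0
    exact Or.inl (subgraphPoly_eq_zero_of_keyPoly_eq_zero lam hv)
  · push Not at h0
    exact h fun v => (hK v).resolve_left (h0 v)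

theorem mvUmbralEval_prod_edgeFactor_ne_zero {S : Set ℂ} (hS : IsLaguerreSet S)
    {s t : E(G) → V(G)} (hst : ∀ e : E(G), G.IsLink e (s e) (t e)) {lam : E(G) → ℂ}
    {u : V(G) → ℕ → ℂ} {x : V(G) → ℂ}
    (hK : ∀ v, ∀ z ∈ S, (G.keyPoly u v).eval (x v * z) ≠ 0) {δ : ℂ} (hδ : δ ∈ S)
    (hlam : ∀ e, ∀ r ∉ S, ∀ r' ∉ S, (r - δ) * (r' - δ) + lam e ≠ 0) :
    mvUmbralEval (fun v j => u v j * x v ^ j) (∏ e, edgeFactor δ (lam e) (s e) (t e)) ≠ 0 := by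
  classical
  refine _root_.mvUmbralEval_prod_edgeFactor_ne_zero hS s t _ (fun v z hz => ?_) lam hδ hlam
  rw [← degreeIn_eq_card_add_card hst]
  exact (umbralEval_mul_pow u v (x v) z).trans_ne (hK v z hz)

/-! ### Disk and exterior -/

theorem eval_subgraphPoly_ne_zero_of_openDisk {lam : E(G) → ℂ} {u : V(G) → ℕ → ℂ} {κ l : ℝ}
    (hκ : 0 < κ) (hl : 0 < l) (hlam : ∀ e, ‖lam e‖ ≤ l)
    (hK : ∀ v, ∀ z ∈ openDisk κ, (G.keyPoly u v).eval z ≠ 0) {x : V(G) → ℂ}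
    (hx : ∀ v, x v ∈ openDisk (κ / √l)) : MvPolynomial.eval x (G.subgraphPoly lam u) ≠ 0 := by
  have hsl : 0 < √l := Real.sqrt_pos.mpr hl
  -- The strict inequality ρ < κ/√l is needed because roots may lie on the circle |r| = κ/ρ; it
  -- gives |r r'| > l ≥ |λ_e|.
  obtain ⟨ρ, ⟨hρ0, hρ⟩, hxρ⟩ : ∃ ρ, ρ ∈ Set.Ioo 0 (κ / √l) ∧ ∀ v, ‖x v‖ < ρ :=
    (Filter.Eventually.and (Ioo_mem_nhdsLT (div_pos hκ hsl)) (Filter.eventually_all.mpr fun v =>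
      nhdsWithin_le_nhds (lt_mem_nhds (hx v)))).exists
  rw [lt_div_iff₀ hsl] at hρ
  obtain ⟨s, t, hst⟩ := G.exists_ends
  rw [eval_subgraphPoly_eq_mvUmbralEval hst]
  refine mvUmbralEval_prod_edgeFactor_ne_zero (isLaguerreSet_openDisk (κ / ρ)) hst
    (fun v z hz => hK v _ ?_) ?_ fun e r hr r' hr' h0 => ?_
  · have hz' : ‖z‖ < κ / ρ := hz
    rw [lt_div_iff₀ hρ0] at hz'
    change ‖x v * z‖ < κ
    rw [norm_mul, mul_comm]
    exact (mul_le_mul_of_nonneg_left (hxρ v).le (norm_nonneg z)).trans_lt hz'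
  · simpa [openDisk] using div_pos hκ hρ0
  · have h1 : κ / ρ ≤ ‖r‖ := not_lt.mp hr
    have h2 : κ / ρ ≤ ‖r'‖ := not_lt.mp hr'
    have h3 : √l < κ / ρ := by rwa [lt_div_iff₀ hρ0, mul_comm]
    have h4 : ‖r‖ * ‖r'‖ = ‖lam e‖ := by
      rw [sub_zero, sub_zero] at h0
      rw [← norm_mul, eq_neg_of_add_eq_zero_left h0, norm_neg]
    have h5 : √l * √l < ‖r‖ * ‖r'‖ :=
      mul_lt_mul'' (h3.trans_le h1) (h3.trans_le h2) hsl.le hsl.le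
    rw [Real.mul_self_sqrt hl.le, h4] at h5
    exact h5.not_ge (hlam e)

/-- Complementation of edge sets reverses the key polynomials. -/
theorem eval_subgraphPoly_eq_reverse {lam : E(G) → ℂ} (hlam : ∀ e, lam e ≠ 0)
    (u : V(G) → ℕ → ℂ) {x : V(G) → ℂ} (hx : ∀ v, x v ≠ 0) :
    MvPolynomial.eval x (G.subgraphPoly lam u) =
      (∏ e, lam e) * (∏ v, x v ^ G.degree v) * MvPolynomial.eval (fun v => (x v)⁻¹)
        (G.subgraphPoly (fun e => (lam e)⁻¹) fun v j => u v (G.degree v - j)) := by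
  classical
  rw [eval_subgraphPoly, eval_subgraphPoly, Finset.mul_sum,
    ← Equiv.sum_comp (compl_involutive (α := Finset E(G))).toPerm]
  refine Finset.sum_congr rfl fun H _ => ?_
  simp only [Function.Involutive.coe_toPerm]
  have h1 : ∏ e ∈ Hᶜ, lam e = (∏ e, lam e) * ∏ e ∈ H, (lam e)⁻¹ := by
    rw [← Finset.prod_mul_prod_compl H, Finset.prod_inv_distrib, mul_right_comm, mul_inv_cancel₀,
      one_mul]
    exact Finset.prod_ne_zero_iff.mpr fun e _ => hlam e
  have h2 : ∀ v, u v (G.degreeIn Hᶜ v) * x v ^ G.degreeIn Hᶜ v =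
      x v ^ G.degree v * (u v (G.degree v - G.degreeIn H v) * (x v)⁻¹ ^ G.degreeIn H v) := by
    intro v
    have hd := degreeIn_add_degreeIn_compl H v
    have hd' : G.degree v - G.degreeIn H v = G.degreeIn Hᶜ v := by omega
    rw [hd', ← hd, pow_add, inv_pow]
    have := pow_ne_zero (G.degreeIn H v) (hx v)
    field_simp
  rw [h1, Finset.prod_congr rfl fun v _ => h2 v, Finset.prod_mul_distrib]
  ring

theorem eval_subgraphPoly_ne_zero_of_openExterior {lam : E(G) → ℂ} {u : V(G) → ℕ → ℂ} {κ l : ℝ}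
    (hκ : 0 < κ) (hl : 0 < l) (hlam : ∀ e, l ≤ ‖lam e‖)
    (hK : ∀ v, ∀ z ∈ openExterior κ, (G.keyPoly u v).eval z ≠ 0)
    (hdeg : ∀ v, (G.keyPoly u v).natDegree = G.degree v) {x : V(G) → ℂ}
    (hx : ∀ v, x v ∈ openExterior (κ / √l)) :
    MvPolynomial.eval x (G.subgraphPoly lam u) ≠ 0 := by
  have hsl : 0 < √l := Real.sqrt_pos.mpr hl
  have hlam0 : ∀ e, lam e ≠ 0 := fun e => norm_pos_iff.mp (hl.trans_le (hlam e))
  have hx0 : ∀ v, x v ≠ 0 := fun v => norm_pos_iff.mp ((div_pos hκ hsl).trans (hx v))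
  rw [eval_subgraphPoly_eq_reverse hlam0 u hx0]
  refine mul_ne_zero (mul_ne_zero (Finset.prod_ne_zero_iff.mpr fun e _ => hlam0 e)
    (Finset.prod_ne_zero_iff.mpr fun v _ => pow_ne_zero _ (hx0 v))) ?_
  refine eval_subgraphPoly_ne_zero_of_openDisk (inv_pos.mpr hκ) (inv_pos.mpr hl)
    (fun e => ?_) (fun v z hz => ?_) fun v => ?_
  · rw [norm_inv]
    exact inv_anti₀ hl (hlam e)
  · rcases eq_or_ne z 0 with rfl | hz0
    -- At z = 0 the reversed polynomial equals the top activity of K_v, nonzero by the degree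
    -- hypothesis.
    · have hne : G.keyPoly u v ≠ 0 := by
        intro h0
        refine hK v (κ + 1 : ℝ) ?_ (by rw [h0, Polynomial.eval_zero])
        change κ < ‖((κ + 1 : ℝ) : ℂ)‖
        rw [Complex.norm_of_nonneg (by linarith)]
        linarith
      have hlead := Polynomial.leadingCoeff_ne_zero.mpr hne
      rw [Polynomial.leadingCoeff, hdeg, coeff_keyPoly u v le_rfl] at hlead
      rw [← Polynomial.coeff_zero_eq_eval_zero, coeff_keyPoly _ v (Nat.zero_le _)]
      simpa using hlead
    · rw [eval_keyPoly_reverse u v hz0]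
      refine mul_ne_zero (pow_ne_zero _ hz0) (hK v _ ?_)
      change κ < ‖z⁻¹‖
      rw [norm_inv]
      exact (lt_inv_comm₀ hκ (norm_pos_iff.mpr hz0)).mpr hz
  · change ‖(x v)⁻¹‖ < κ⁻¹ / √(l⁻¹)
    rw [norm_inv, Real.sqrt_inv, inv_div_inv, ← inv_div]
    exact inv_strictAnti₀ (div_pos hκ hsl) (hx v)

/-! ### Sectors -/

theorem _root_.isOpen_openSector {θ : ℝ} (hθ : θ ≤ Real.pi) : IsOpen (openSector θ) := by
  rw [isOpen_iff_mem_nhds]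
  rintro z ⟨hz0, hz⟩
  have hslit : z ∈ Complex.slitPlane :=
    Complex.mem_slitPlane_iff_arg.mpr ⟨fun h => by
      rw [h, abs_of_pos Real.pi_pos] at hz
      linarith, hz0⟩
  filter_upwards [isOpen_ne.mem_nhds hz0,
    (Complex.continuousAt_arg hslit).abs.eventually_lt_const hz] with w h1 h2 using ⟨h1, h2⟩

theorem _root_.mul_mem_openSector {a b : ℝ} (hab : a + b ≤ Real.pi) {x z : ℂ}
    (hx : x ∈ openSector a) (hz : z ∈ openSector b) : x * z ∈ openSector (a + b) := by
  obtain ⟨hx0, hxa⟩ := hx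
  obtain ⟨hz0, hzb⟩ := hz
  have hx' := abs_lt.mp hxa
  have hz' := abs_lt.mp hzb
  refine ⟨mul_ne_zero hx0 hz0, ?_⟩
  rw [Complex.arg_mul hx0 hz0 ⟨by linarith, by linarith⟩, abs_lt]
  constructor <;> linarith

/-- Arguments of w and w' can be taken in (π/2, 3π/2), so that of w w' lies in (π, 3π) and w w' is
not in (-∞, 0]. -/
theorem _root_.mul_add_nonneg_ne_zero {w w' l : ℂ} (hw : w.re < 0) (hw' : w'.re < 0)
    (hl : 0 ≤ l) : w * w' + l ≠ 0 := by
  intro h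
  obtain ⟨hl0, hli⟩ := Complex.le_def.mp hl
  have hre := congrArg Complex.re h
  have him := congrArg Complex.im h
  simp only [Complex.add_re, Complex.mul_re, Complex.zero_re, Complex.add_im, Complex.mul_im,
    Complex.zero_im] at hre him hl0 hli
  have h1 : 0 < w.re * w'.re := mul_pos_of_neg_of_neg hw hw'
  have h2 : 0 < w.im * w'.im := by linarith
  have h3 : 0 < -w.re * (w.im * w'.im) := mul_pos (by linarith) h2
  have h4 : w.im ^ 2 * w'.re ≤ 0 := mul_nonpos_of_nonneg_of_nonpos (sq_nonneg _) hw'.le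
  have h5 : -w.re * (w.im * w'.im) = w.im ^ 2 * w'.re := by
    linear_combination -w.im * hli - w.im * him
  linarith

theorem eval_subgraphPoly_eq_zero_of_openSector {lam : E(G) → ℂ} {u : V(G) → ℕ → ℂ} {a : ℝ}
    (ha : 0 ≤ a) (hlam : ∀ e, 0 ≤ lam e)
    (hK : ∀ v, ∀ z ∈ openSector (Real.pi - a), (G.keyPoly u v).eval z ≠ 0) {x : V(G) → ℂ}
    (hx : ∀ v, x v ∈ openSector (Real.pi / 2 - a))
    (h0 : MvPolynomial.eval x (G.subgraphPoly lam u) = 0) (y : V(G) → ℂ) :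
    MvPolynomial.eval y (G.subgraphPoly lam u) = 0 := by
  obtain ⟨s, t, hst⟩ := G.exists_ends
  rw [eval_subgraphPoly_eq_mvUmbralEval hst] at h0 ⊢
  -- The inner variable is δ; the outer one, w, parametrizes the complex line x + (y - x)w, reaching
  -- y at w = 1.
  set p : Polynomial (Polynomial ℂ) := mvUmbralEval (fun v j =>
      Polynomial.C (Polynomial.C (u v j)) * (Polynomial.C (Polynomial.C (x v)) +
        Polynomial.C (Polynomial.C (y v - x v)) * Polynomial.X) ^ j)
    (∏ e, edgeFactor (Polynomial.C Polynomial.X) (Polynomial.C (Polynomial.C (lam e)))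
      (s e) (t e)) with hp
  have heval : ∀ δ w : ℂ, p.evalEval δ w =
      mvUmbralEval (fun v j => u v j * (x v + (y v - x v) * w) ^ j)
        (∏ e, edgeFactor δ (lam e) (s e) (t e)) := by
    intro δ w
    rw [← Polynomial.coe_evalEvalRingHom, hp, map_mvUmbralEval, map_prod]
    simp only [map_edgeFactor, Polynomial.coe_evalEvalRingHom, Polynomial.evalEval_mul,
      Polynomial.evalEval_pow, Polynomial.evalEval_add, Polynomial.evalEval_C,
      Polynomial.evalEval_X, Polynomial.eval_C, Polynomial.eval_X]
  obtain ⟨r, hr, hxr⟩ : ∃ r > 0, ∀ w : ℂ, ‖w‖ < r →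
      ∀ v, x v + (y v - x v) * w ∈ openSector (Real.pi / 2 - a) := by
    have hev : ∀ᶠ w : ℂ in nhds 0, ∀ v, x v + (y v - x v) * w ∈ openSector (Real.pi / 2 - a) := by
      refine Filter.eventually_all.mpr fun v => ?_
      have hc : Continuous fun w : ℂ => x v + (y v - x v) * w := by fun_prop
      refine hc.continuousAt.eventually_mem ((isOpen_openSector ?_).mem_nhds ?_)
      · linarith [Real.pi_pos]
      · simpa using hx v
    obtain ⟨r, hr, h⟩ := Metric.eventually_nhds_iff.mp hev
    exact ⟨r, hr, fun w hw => h (by simpa using hw)⟩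
  have hmain := Polynomial.evalEval_zero_eq_zero (p := p) hr (fun δ hδ w hw => ?_) ?_ 1
  · rw [heval] at hmain
    simpa using hmain
  · rw [heval]
    refine mvUmbralEval_prod_edgeFactor_ne_zero isLaguerreSet_rightHalfPlane hst
      (x := fun v => x v + (y v - x v) * w) (fun v z (hz : 0 < z.re) => hK v _ ?_)
      (by simpa using hδ) fun e q hq q' hq' => ?_
    · have hz' : z ∈ openSector (Real.pi / 2) :=
        ⟨fun h => by simp [h] at hz, Complex.abs_arg_lt_pi_div_two_iff.mpr (Or.inl hz)⟩
      have := mul_mem_openSector (by linarith) (hxr w hw v) hz'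
      rwa [show Real.pi / 2 - a + Real.pi / 2 = Real.pi - a by ring] at this
    -- Subtracting δ > 0 makes both real parts strictly negative.
    · have h1 : q.re ≤ 0 := not_lt.mp hq
      have h2 : q'.re ≤ 0 := not_lt.mp hq'
      refine mul_add_nonneg_ne_zero ?_ ?_ (hlam e) <;>
        rw [Complex.sub_re, Complex.ofReal_re] <;> linarith
  · rw [heval]
    simpa using h0

end Graph

theorem theorem3p2 {α β : Type*} (G : Graph α β) [Fintype V(G)] [Fintype E(G)]
    (lam : E(G) → ℂ) (u : V(G) → ℕ → ℂ) :
    (∀ a : ℝ, 0 ≤ a → a < Real.pi / 2 →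
      (∀ e, 0 ≤ lam e) →
      (∀ v, (G.keyPoly u v).IsNonvanishing (openSector (Real.pi - a))) →
      (G.subgraphPoly lam u).IsNonvanishing (openSector (Real.pi / 2 - a))) ∧
    (∀ κ lmax : ℝ, 0 < κ → 0 < lmax →
      (∀ e, ‖lam e‖ ≤ lmax) →
      (∀ v, (G.keyPoly u v).IsNonvanishing (openDisk κ)) →
      (G.subgraphPoly lam u).IsNonvanishing (openDisk (κ / √lmax))) ∧
    (∀ κ lmin : ℝ, 0 < κ → 0 < lmin →
      (∀ e, lmin ≤ ‖lam e‖) →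
      (∀ v, (G.keyPoly u v).IsNonvanishing (openExterior κ)) →
      (∀ v, (G.keyPoly u v).natDegree = G.degree v) →
      (G.subgraphPoly lam u).IsNonvanishing (openExterior (κ / √lmin))) := by
  refine ⟨fun a ha _ hlam hK => ?_, fun κ l hκ hl hlam hK => ?_,
    fun κ l hκ hl hlam hK hdeg => ?_⟩ <;>
    refine Graph.subgraphPoly_isNonvanishing_of hK fun hK' => ?_
  · refine or_iff_not_imp_right.mpr fun hz => ?_
    push Not at hz
    obtain ⟨x, hx, h0⟩ := hz
    refine MvPolynomial.funext fun y => ?_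
    rw [map_zero]
    exact Graph.eval_subgraphPoly_eq_zero_of_openSector ha hlam hK' hx h0 y
  · exact Or.inr fun x hx => Graph.eval_subgraphPoly_ne_zero_of_openDisk hκ hl hlam hK' hx
  · exact Or.inr fun x hx =>
      Graph.eval_subgraphPoly_ne_zero_of_openExterior hκ hl hlam hK' hdeg hx
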